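/- Let $R$ be a commutative Noetherian ring and let $I,J$ be ideals of $R$. Put $$W(I,J)=\{\mathfrak p\in\operatorname{Spec}(R)\mid I^k\subseteq\mathfrak p+J\ \text{for some integer } k\ge 1\},$$ and for an $R$-module $N$ let $\Gamma_{I,J}(N)=\{x\in N\mid \operatorname{Supp}_R(Rx)\subseteq W(I,J)\}$. For $i\ge 0$ let $H^i_{I,J}$ be the $i$-th right derived functor of the functor $\Gamma_{I,J}$ on the category of $R$-modules. Let $\mathcal S$ be a Serre class of $R$-modules, that is, a class of $R$-modules containing the zero module and closed under submodules, quotients and extensions (and hence under isomorphism). Let $M$ be a finitely generated $R$-module and let $n\ge 0$ be an integer such that $H^i_{I,J}(M)\in\mathcal S$ for all $i>n$. If $\mathfrak b$ is an ideal of $R$ such that $H^n_{I,J}(M/\mathfrak bM)\in\mathcal S$, then $H^n_{I,J}(M)/\mathfrak bH^n_{I,J}(M)\in\mathcal S$. -/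

import Mathlib

open CategoryTheory

universe u

section PairLocalCohomology

variable {R : Type u} [CommRing R]

/-- The set `W(I,J)` of primes `p` of `R` with `I ^ n ⊆ p + J` for some `n ≥ 1`. -/
def pairW (I J : Ideal R) : Set (PrimeSpectrum R) :=
  {p | ∃ n : ℕ, 1 ≤ n ∧ I ^ n ≤ p.asIdeal ⊔ J}

/-- The support of a cyclic submodule is cut out by the annihilator of its generator. -/
theorem mem_support_span_singleton_iff {N : Type u} [AddCommGroup N] [Module R N] (x : N)
    (p : PrimeSpectrum R) :
    p ∈ Module.support R (Submodule.span R {x}) ↔ ∀ r : R, r • x = 0 → r ∈ p.asIdeal := by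
  rw [Module.support_eq_zeroLocus, PrimeSpectrum.mem_zeroLocus]
  constructor
  · intro h r hr
    exact h ((Submodule.mem_annihilator_span_singleton x r).2 hr)
  · intro h r hr
    exact h r ((Submodule.mem_annihilator_span_singleton x r).1 hr)

/-- The `(I,J)`-torsion submodule of `N`: all `x` with `Supp (R x) ⊆ W(I,J)`. -/
def pairTorsion (I J : Ideal R) (N : Type u) [AddCommGroup N] [Module R N] :
    Submodule R N where
  carrier := {x | Module.support R (Submodule.span R {x}) ⊆ pairW I J}
  zero_mem' := by
    intro p hp
    rw [mem_support_span_singleton_iff] at hp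
    exact absurd (hp 1 (smul_zero 1)) ((Ideal.ne_top_iff_one _).1 p.2.ne_top)
  add_mem' := by
    intro x y hx hy p hp
    rw [mem_support_span_singleton_iff] at hp
    by_cases h : p ∈ Module.support R (Submodule.span R {x})
    · exact hx h
    · refine hy ((mem_support_span_singleton_iff y p).2 fun r hr => ?_)
      rw [mem_support_span_singleton_iff] at h
      push Not at h
      obtain ⟨s, hs, hsp⟩ := h
      refine (p.2.mem_or_mem (hp (s * r) ?_)).resolve_left hsp
      rw [smul_add, mul_smul s r y, hr, mul_comm, mul_smul, hs]
      simp
  smul_mem' := by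
    intro a x hx p hp
    rw [mem_support_span_singleton_iff] at hp
    refine hx ((mem_support_span_singleton_iff x p).2 fun r hr => hp r ?_)
    rw [smul_comm, hr, smul_zero]

theorem map_mem_pairTorsion (I J : Ideal R) {N N' : Type u} [AddCommGroup N] [Module R N]
    [AddCommGroup N'] [Module R N'] (f : N →ₗ[R] N') (x : N) (hx : x ∈ pairTorsion I J N) :
    f x ∈ pairTorsion I J N' := by
  intro p hp
  rw [mem_support_span_singleton_iff] at hp
  refine hx ((mem_support_span_singleton_iff x p).2 fun r hr => hp r ?_)
  rw [← map_smul, hr, map_zero]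

/-- The `(I,J)`-torsion functor on `R`-modules; a linear map acts by restriction. -/
def pairTorsionFunctor (I J : Ideal R) : ModuleCat.{u} R ⥤ ModuleCat.{u} R where
  obj N := ModuleCat.of R (pairTorsion I J N)
  map f := ModuleCat.ofHom (f.hom.restrict (map_mem_pairTorsion I J f.hom))

instance pairTorsionFunctor_additive (I J : Ideal R) : (pairTorsionFunctor I J).Additive where

/-- The `i`-th local cohomology functor with respect to the pair `(I,J)`: the `i`-th right
derived functor of the `(I,J)`-torsion functor. -/
noncomputable def pairLocalCohomology (I J : Ideal R) (i : ℕ) :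
    ModuleCat.{u} R ⥤ ModuleCat.{u} R :=
  (pairTorsionFunctor I J).rightDerived i

end PairLocalCohomology

/-! Write `b = (x₁, …, x_m)` and let `φ : M^m → M` be `Σ xⱼ · projⱼ`, with image `bM`. By additivity
and linearity, `Hⁿ(φ) = Σ xⱼ Hⁿ(projⱼ)` has image inside `bHⁿ(M)`, so `Hⁿ(M)/bHⁿ(M)` is a quotient
of `coker Hⁿ(φ)`, and it suffices that this cokernel lies in `S`. Factor `φ` as `M^m ↠ bM ↪ M`:
modulo `S` the second map is onto on `Hⁿ` because `Hⁿ(M/bM) ∈ S`, the first because `Hⁿ⁺¹(ker φ) ∈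
S`.

The last membership is the main point (`prop_pairLocalCohomology_of_annihilator_le`): if `Hⁱ(M) ∈ S`
for all `i > n`, the same holds for every finite `N` killed by `Ann M`. It is proved by descending
induction on `i`; the step uses prime filtrations and nonzero maps `M → R/p`.

The induction starts because `Hⁱ` vanishes once `i` exceeds the number of generators of `I`: by
`pairTorsion_eq_listTorsion`, `Γ_{I,J}` is an intersection of torsion functors for multiplicative
sets, one per generator, and each of them costs one degree of exactness. -/

/-! ### Horseshoe lemma for injective resolutions. -/

section Horseshoe

open Limits

universe v w

variable {C : Type w} [Category.{v} C] [Abelian C]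

namespace CategoryTheory.InjectiveResolution

/-- The augmentation of an injective resolution. -/
noncomputable def aug {Z : C} (P : InjectiveResolution Z) : Z ⟶ P.cocomplex.X 0 := P.ι.f 0

instance {Z : C} (P : InjectiveResolution Z) : Mono P.aug :=
  inferInstanceAs (Mono (P.ι.f 0))

@[simp]
theorem aug_d {Z : C} (P : InjectiveResolution Z) : P.aug ≫ P.cocomplex.d 0 1 = 0 :=
  P.ι_f_zero_comp_complex_d

theorem exact_aug {Z : C} (P : InjectiveResolution Z) :
    (ShortComplex.mk _ _ P.aug_d).Exact :=
  P.exact₀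

/-- The injective resolution given by an augmented cochain complex of injectives which is exact. -/
noncomputable def ofExact {Z : C} (K : CochainComplex C ℕ) (hK : ∀ n, Injective (K.X n))
    (a : Z ⟶ K.X 0) [Mono a] (w : a ≫ K.d 0 1 = 0) (h₀ : (ShortComplex.mk _ _ w).Exact)
    (h : ∀ n, K.ExactAt (n + 1)) : InjectiveResolution Z where
  cocomplex := K
  injective := hK
  ι := (CochainComplex.fromSingle₀Equiv _ _).symm ⟨a, w⟩
  quasiIso := ⟨fun n => by
    cases n
    · rw [CochainComplex.quasiIsoAt₀_iff, ShortComplex.quasiIso_iff_of_zeros]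
      · refine (ShortComplex.exact_and_mono_f_iff_of_iso ?_).2 ⟨h₀, by dsimp; infer_instance⟩
        exact ShortComplex.isoMk (Iso.refl _) (Iso.refl _) (Iso.refl _)
          ((Category.id_comp _).trans
            ((CochainComplex.fromSingle₀Equiv_symm_apply_f_zero a w).symm.trans
              (Category.comp_id _).symm))
          ((Category.id_comp _).trans (Category.comp_id _).symm)
      · rfl
      · rfl
      -- Degree 0 has no predecessor; the incoming map is read as `K.d 0 0`, which is zero.
      · exact K.shape 0 0 (by simp)
    · rw [quasiIsoAt_iff_exactAt]
      · exact h _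
      · apply CochainComplex.exactAt_succ_single_obj⟩

theorem ofExact_aug {Z : C} (K : CochainComplex C ℕ) (hK : ∀ n, Injective (K.X n))
    (a : Z ⟶ K.X 0) [Mono a] (w : a ≫ K.d 0 1 = 0) (h₀ : (ShortComplex.mk _ _ w).Exact)
    (h : ∀ n, K.ExactAt (n + 1)) : (ofExact K hK a w h₀ h).aug = a :=
  CochainComplex.fromSingle₀Equiv_symm_apply_f_zero _ _

variable {S : ShortComplex C} (hS : S.ShortExact)
  (P : InjectiveResolution S.X₁) (Q : InjectiveResolution S.X₃)

include hS in
/-- The augmentation `X₁ ⟶ P⁰` extends to `X₂`. -/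
theorem exists_extension_aug : ∃ k : S.X₂ ⟶ P.cocomplex.X 0, S.f ≫ k = P.aug := by
  have := hS.mono_f
  exact ⟨Injective.factorThru P.aug S.f, Injective.comp_factorThru _ _⟩

/-- The relations satisfied by the off-diagonal part of the differential in the
horseshoe lemma. -/
structure IsTwist (k : S.X₂ ⟶ P.cocomplex.X 0)
    (t : ∀ n, Q.cocomplex.X n ⟶ P.cocomplex.X (n + 1)) : Prop where
  zero : k ≫ P.cocomplex.d 0 1 + S.g ≫ Q.aug ≫ t 0 = 0
  succ (n : ℕ) : t n ≫ P.cocomplex.d (n + 1) (n + 2) + Q.cocomplex.d n (n + 1) ≫ t (n + 1) = 0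

include hS in
-- Since `-(k ≫ d)` kills `X₁`, it descends to `X₃` and extends to `Q⁰`, giving `t 0`. Each later
-- `t` extends a map that vanishes on the previous cocycles, using exactness of `Q` and injectivity
-- of the terms of `P`.
theorem exists_isTwist (k : S.X₂ ⟶ P.cocomplex.X 0) (hk : S.f ≫ k = P.aug) :
    ∃ t, IsTwist P Q k t := by
  have := hS.epi_g
  obtain ⟨c, hc⟩ : ∃ c : S.X₃ ⟶ P.cocomplex.X 1, S.g ≫ c = -(k ≫ P.cocomplex.d 0 1) := by
    refine ⟨hS.exact.desc (-(k ≫ P.cocomplex.d 0 1)) ?_, hS.exact.g_desc _ _⟩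
    rw [Preadditive.comp_neg, ← Category.assoc, hk, aug_d, neg_zero]
  obtain ⟨z, hz⟩ : ∃ z : Q.cocomplex.X 0 ⟶ P.cocomplex.X 1, Q.aug ≫ z = c :=
    ⟨Injective.factorThru c Q.aug, Injective.comp_factorThru _ _⟩
  have hz' : Q.aug ≫ (-(z ≫ P.cocomplex.d 1 2)) = 0 := by
    rw [Preadditive.comp_neg, reassoc_of% hz, ← cancel_epi S.g, Preadditive.comp_neg,
      reassoc_of% hc]
    simp
  -- The recursion carries two consecutive twists with their relation, since constructing the next
  -- twist uses that relation.
  let T (n : ℕ) := {p : (Q.cocomplex.X n ⟶ P.cocomplex.X (n + 1)) ×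
    (Q.cocomplex.X (n + 1) ⟶ P.cocomplex.X (n + 2)) //
      p.1 ≫ P.cocomplex.d (n + 1) (n + 2) + Q.cocomplex.d n (n + 1) ≫ p.2 = 0}
  have step (n : ℕ) (p : T n) : ∃ q : T (n + 1), q.1.1 = p.1.2 := by
    obtain ⟨⟨p, q⟩, h⟩ := p
    have hq : Q.cocomplex.d n (n + 1) ≫ (-(q ≫ P.cocomplex.d (n + 2) (n + 3))) = 0 := by
      rw [Preadditive.comp_neg, ← Category.assoc, eq_neg_of_add_eq_zero_right h]
      simp
    exact ⟨⟨⟨q, (Q.exact_succ n).descToInjective _ hq⟩, by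
      rw [(Q.exact_succ n).comp_descToInjective, add_neg_cancel]⟩, rfl⟩
  choose next hnext using step
  let r : ∀ n, T n := fun n => Nat.rec ⟨⟨z, Q.exact_aug.descToInjective _ hz'⟩, by
    rw [Q.exact_aug.comp_descToInjective, add_neg_cancel]⟩ next n
  refine ⟨fun n => (r n).1.1, ?_, fun n => ?_⟩
  · change k ≫ P.cocomplex.d 0 1 + S.g ≫ Q.aug ≫ z = 0
    rw [hz, hc, add_neg_cancel]
  · have h : (r (n + 1)).1.1 = (r n).1.2 := hnext n (r n)
    rw [h]
    exact (r n).2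

variable {P Q} {k : S.X₂ ⟶ P.cocomplex.X 0}
  {t : ∀ n, Q.cocomplex.X n ⟶ P.cocomplex.X (n + 1)} (ht : IsTwist P Q k t)

/-- The differential of the middle complex of the horseshoe lemma. -/
noncomputable def horseshoeD (t : ∀ n, Q.cocomplex.X n ⟶ P.cocomplex.X (n + 1)) (n : ℕ) :
    P.cocomplex.X n ⊞ Q.cocomplex.X n ⟶ P.cocomplex.X (n + 1) ⊞ Q.cocomplex.X (n + 1) :=
  biprod.desc (biprod.lift (P.cocomplex.d n (n + 1)) 0)
    (biprod.lift (t n) (Q.cocomplex.d n (n + 1)))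

theorem inl_horseshoeD (n : ℕ) :
    biprod.inl ≫ horseshoeD t n = P.cocomplex.d n (n + 1) ≫ biprod.inl := by
  apply biprod.hom_ext <;> simp [horseshoeD]

theorem horseshoeD_snd (n : ℕ) :
    horseshoeD t n ≫ biprod.snd = biprod.snd ≫ Q.cocomplex.d n (n + 1) := by
  apply biprod.hom_ext' <;> simp [horseshoeD]

theorem horseshoeD_fst (n : ℕ) : horseshoeD t n ≫ biprod.fst =
    biprod.fst ≫ P.cocomplex.d n (n + 1) + biprod.snd ≫ t n := by
  apply biprod.hom_ext' <;> simp [horseshoeD]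

include ht in
theorem horseshoeD_comp (n : ℕ) : horseshoeD t n ≫ horseshoeD t (n + 1) = 0 := by
  apply biprod.hom_ext' <;> apply biprod.hom_ext <;> simp [horseshoeD, ht.succ]

/-- The middle complex of the horseshoe lemma. -/
noncomputable def horseshoeComplex : CochainComplex C ℕ :=
  CochainComplex.of (fun n => P.cocomplex.X n ⊞ Q.cocomplex.X n) (horseshoeD t)
    (horseshoeD_comp ht)

theorem horseshoeComplex_d (n : ℕ) :
    (horseshoeComplex ht).d n (n + 1) = horseshoeD t n :=
  CochainComplex.of_d (fun n => P.cocomplex.X n ⊞ Q.cocomplex.X n) (horseshoeD t) n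

/-- The inclusion of the first complex into the middle complex of the horseshoe lemma. -/
noncomputable def horseshoeInl : P.cocomplex ⟶ horseshoeComplex ht where
  f n := (biprod.inl : P.cocomplex.X n ⟶ P.cocomplex.X n ⊞ Q.cocomplex.X n)
  comm' i j hij := by
    obtain rfl : i + 1 = j := hij
    rw [horseshoeComplex_d]
    exact inl_horseshoeD i

/-- The projection of the middle complex of the horseshoe lemma to the last complex. -/
noncomputable def horseshoeSnd : horseshoeComplex ht ⟶ Q.cocomplex where
  f n := (biprod.snd : P.cocomplex.X n ⊞ Q.cocomplex.X n ⟶ Q.cocomplex.X n)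
  comm' i j hij := by
    obtain rfl : i + 1 = j := hij
    rw [horseshoeComplex_d]
    exact (horseshoeD_snd i).symm

/-- The short complex of cochain complexes of the horseshoe lemma. -/
noncomputable def horseshoeShortComplex : ShortComplex (CochainComplex C ℕ) :=
  ShortComplex.mk (horseshoeInl ht) (horseshoeSnd ht) (by
    ext n
    exact biprod.inl_snd)

/-- The horseshoe sequence is degreewise split. -/
noncomputable def horseshoeSplitting (n : ℕ) :
    ((horseshoeShortComplex ht).map (HomologicalComplex.eval C _ n)).Splitting :=
  ShortComplex.Splitting.ofHasBinaryBiproduct (P.cocomplex.X n) (Q.cocomplex.X n)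

theorem horseshoeShortComplex_shortExact : (horseshoeShortComplex ht).ShortExact :=
  HomologicalComplex.shortExact_of_degreewise_shortExact _ fun n =>
    (horseshoeSplitting ht n).shortExact

include hS in
/-- The horseshoe lemma for injective resolutions. -/
theorem exists_horseshoe (P : InjectiveResolution S.X₁) (Q : InjectiveResolution S.X₃) :
    ∃ (I : InjectiveResolution S.X₂) (α : P.cocomplex ⟶ I.cocomplex)
      (β : I.cocomplex ⟶ Q.cocomplex) (w : α ≫ β = 0),
      S.f ≫ I.aug = P.aug ≫ α.f 0 ∧ S.g ≫ Q.aug = I.aug ≫ β.f 0 ∧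
      ∀ n, Nonempty ((ShortComplex.mk α β w).map (HomologicalComplex.eval C _ n)).Splitting := by
  obtain ⟨k, hk⟩ := exists_extension_aug hS P
  obtain ⟨t, ht⟩ := exists_isTwist hS P Q k hk
  have hmf := hS.mono_f
  let a : S.X₂ ⟶ P.cocomplex.X 0 ⊞ Q.cocomplex.X 0 := biprod.lift k (S.g ≫ Q.aug)
  have ha : S.f ≫ a = P.aug ≫ biprod.inl := by
    apply biprod.hom_ext <;> simp [a, hk]
  have ha' : a ≫ biprod.snd = S.g ≫ Q.aug := biprod.lift_snd _ _
  have hma : Mono a := Preadditive.mono_of_cancel_zero _ fun {W} f hf => by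
    have h1 : f ≫ S.g = 0 := by
      rw [← cancel_mono Q.aug]
      simpa [a] using hf =≫ biprod.snd
    obtain ⟨l, rfl⟩ : ∃ l, l ≫ S.f = f := ⟨_, hS.exact.lift_f f h1⟩
    have h2 : l ≫ P.aug = 0 := by
      simpa [a, hk] using hf =≫ biprod.fst
    rw [(cancel_mono P.aug).1 (h2.trans zero_comp.symm), zero_comp]
  have w : a ≫ horseshoeD t 0 = 0 := by
    apply biprod.hom_ext
    · simpa [a, horseshoeD_fst] using ht.zero
    · simp [a, horseshoeD_snd]
  have h₀ : (ShortComplex.mk a _ w).Exact := by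
    rw [ShortComplex.exact_iff_exact_up_to_refinements]
    intro W x hx
    dsimp only at x hx
    have hx2 : (x ≫ biprod.snd) ≫ Q.cocomplex.d 0 1 = 0 := by
      simpa [horseshoeD_snd] using hx =≫ biprod.snd
    have hQ := Q.exact_aug
    obtain ⟨c, hc⟩ : ∃ c, c ≫ Q.aug = x ≫ biprod.snd := ⟨_, hQ.lift_f _ hx2⟩
    have := hS.epi_g
    obtain ⟨W', π, hπ, y, hy⟩ := surjective_up_to_refinements_of_epi S.g c
    -- Subtracting the image of `y` clears the `Q⁰` component; what remains is a cocycle in `P⁰`,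
    -- hence comes from `X₁`.
    have h1 : (π ≫ x - y ≫ a) ≫ biprod.snd = 0 := by
      rw [Preadditive.sub_comp, Category.assoc, Category.assoc, ← hc, ha', reassoc_of% hy,
        sub_self]
    have h2 : ((π ≫ x - y ≫ a) ≫ biprod.fst) ≫ P.cocomplex.d 0 1 = 0 := by
      have h3 : (π ≫ x - y ≫ a) ≫ horseshoeD t 0 = 0 := by
        rw [Preadditive.sub_comp, Category.assoc, Category.assoc, hx, w, comp_zero, comp_zero,
          sub_self]
      have h4 := h3 =≫ biprod.fst
      rwa [Category.assoc, horseshoeD_fst, Preadditive.comp_add, reassoc_of% h1, zero_comp,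
        add_zero, ← Category.assoc, zero_comp] at h4
    obtain ⟨e, he⟩ : ∃ e, e ≫ P.aug = (π ≫ x - y ≫ a) ≫ biprod.fst :=
      ⟨_, P.exact_aug.lift_f _ h2⟩
    refine ⟨W', π, hπ, y + e ≫ S.f, ?_⟩
    rw [Preadditive.add_comp, Category.assoc, ha, ← sub_eq_iff_eq_add', reassoc_of% he]
    apply biprod.hom_ext
    · simp
    · rw [h1]
      simp
  have w' : (show S.X₂ ⟶ (horseshoeComplex ht).X 0 from a) ≫ (horseshoeComplex ht).d 0 1 = 0 := by
    rw [horseshoeComplex_d]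
    exact w
  have h₀' : (ShortComplex.mk _ _ w').Exact := by
    simp only [horseshoeComplex_d]
    exact h₀
  have hma' : Mono (show S.X₂ ⟶ (horseshoeComplex ht).X 0 from a) := hma
  refine ⟨ofExact (horseshoeComplex ht) (fun n => ?_) _ w' h₀' fun n => ?_,
    horseshoeInl ht, horseshoeSnd ht, (horseshoeShortComplex ht).zero, ?_, ?_,
    fun n => ⟨horseshoeSplitting ht n⟩⟩
  · exact inferInstanceAs (Injective (P.cocomplex.X n ⊞ Q.cocomplex.X n))
  · exact (horseshoeShortComplex_shortExact ht).exactAt_X₂ _ (P.cocomplex_exactAt_succ n)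
      (Q.cocomplex_exactAt_succ n)
  · exact Eq.trans (congrArg (S.f ≫ ·) (ofExact_aug ..)) ha
  · exact Eq.trans ha'.symm (congrArg (· ≫ (horseshoeSnd ht).f 0) (ofExact_aug ..)).symm

end CategoryTheory.InjectiveResolution

end Horseshoe

/-! ### Long exact sequence, additivity and linearity of right derived functors. -/

section LongExact

open Limits

universe v w v' w'

variable {C : Type w} [Category.{v} C] [Abelian C] [HasInjectiveResolutions C]
  {D : Type w'} [Category.{v'} D] [Abelian D] (F : C ⥤ D) [F.Additive]

namespace CategoryTheory.Functor

/-- A short exact sequence has injective resolutions fitting into a short exact sequence which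
stays exact after applying any additive functor. -/
theorem exists_shortExact_rightDerived {S : ShortComplex C} (hS : S.ShortExact) :
    ∃ T : ShortComplex (CochainComplex D ℕ), T.ShortExact ∧
      ∃ (e₁ : ∀ n, (F.rightDerived n).obj S.X₁ ≅ T.X₁.homology n)
        (e₂ : ∀ n, (F.rightDerived n).obj S.X₂ ≅ T.X₂.homology n)
        (e₃ : ∀ n, (F.rightDerived n).obj S.X₃ ≅ T.X₃.homology n),
      (∀ n, (F.rightDerived n).map S.f ≫ (e₂ n).hom =
        (e₁ n).hom ≫ HomologicalComplex.homologyMap T.f n) ∧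
      (∀ n, (F.rightDerived n).map S.g ≫ (e₃ n).hom =
        (e₂ n).hom ≫ HomologicalComplex.homologyMap T.g n) := by
  let P := injectiveResolution S.X₁
  let Q := injectiveResolution S.X₃
  obtain ⟨I, α, β, w, hα, hβ, hs⟩ := InjectiveResolution.exists_horseshoe hS P Q
  refine ⟨(ShortComplex.mk α β w).map (F.mapHomologicalComplex _),
    HomologicalComplex.shortExact_of_degreewise_shortExact _ fun n =>
      ((hs n).some.map F).shortExact,
    fun n => P.isoRightDerivedObj F n, fun n => I.isoRightDerivedObj F n,
    fun n => Q.isoRightDerivedObj F n, fun n => ?_, fun n => ?_⟩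
  · exact InjectiveResolution.isoRightDerivedObj_hom_naturality S.f P I α hα.symm F n
  · exact InjectiveResolution.isoRightDerivedObj_hom_naturality S.g I Q β hβ.symm F n

/-- The derived map can be computed from any lift to resolutions, and a sum of lifts lifts the sum.
-/
instance rightDerived_additive (n : ℕ) : (F.rightDerived n).Additive where
  map_add {X Y f g} := by
    let P := injectiveResolution X
    let Q := injectiveResolution Y
    have key (h : X ⟶ Y) (φ : P.cocomplex ⟶ Q.cocomplex) (comm : P.aug ≫ φ.f 0 = h ≫ Q.aug) :=
      InjectiveResolution.isoRightDerivedObj_hom_naturality h P Q φ comm F n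
    obtain ⟨φ, hφ⟩ : ∃ φ : P.cocomplex ⟶ Q.cocomplex, P.aug ≫ φ.f 0 = f ≫ Q.aug :=
      ⟨InjectiveResolution.desc f Q P, InjectiveResolution.desc_commutes_zero f Q P⟩
    obtain ⟨ψ, hψ⟩ : ∃ ψ : P.cocomplex ⟶ Q.cocomplex, P.aug ≫ ψ.f 0 = g ≫ Q.aug :=
      ⟨InjectiveResolution.desc g Q P, InjectiveResolution.desc_commutes_zero g Q P⟩
    rw [← cancel_mono (Q.isoRightDerivedObj F n).hom, Preadditive.add_comp, key f φ hφ, key g ψ hψ,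
      key (f + g) (φ + ψ) (by simp [hφ, hψ]), Functor.map_add, Preadditive.comp_add]

theorem rightDerived_exact₂ {S : ShortComplex C} (hS : S.ShortExact) (n : ℕ) :
    (ShortComplex.mk ((F.rightDerived n).map S.f) ((F.rightDerived n).map S.g)
      (by rw [← Functor.map_comp, S.zero, (F.rightDerived n).map_zero])).Exact := by
  obtain ⟨T, hT, e₁, e₂, e₃, hf, hg⟩ := F.exists_shortExact_rightDerived hS
  exact ShortComplex.exact_of_iso
    (ShortComplex.isoMk (e₁ n) (e₂ n) (e₃ n) (hf n).symm (hg n).symm).symm (hT.homology_exact₂ n)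

theorem rightDerived_exact₃ {S : ShortComplex C} (hS : S.ShortExact) (n : ℕ) :
    ∃ (δ : (F.rightDerived n).obj S.X₃ ⟶ (F.rightDerived (n + 1)).obj S.X₁)
      (w : (F.rightDerived n).map S.g ≫ δ = 0), (ShortComplex.mk _ _ w).Exact := by
  obtain ⟨T, hT, e₁, e₂, e₃, hf, hg⟩ := F.exists_shortExact_rightDerived hS
  have hg' := hg n
  refine ⟨(e₃ n).hom ≫ hT.δ n (n + 1) rfl ≫ (e₁ (n + 1)).inv, ?_, ?_⟩
  · have h := hT.comp_δ n (n + 1) rfl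
    rw [reassoc_of% hg', reassoc_of% h, zero_comp, comp_zero]
  · exact ShortComplex.exact_of_iso
      (ShortComplex.isoMk (e₂ n) (e₃ n) (e₁ (n + 1)) hg'.symm (by simp)).symm
      (hT.homology_exact₃ n (n + 1) rfl)

/-- Multiplication by `r` on a resolution lifts multiplication by `r` on `X`. -/
theorem rightDerived_map_smul {R : Type*} [Ring R] [CategoryTheory.Linear R C]
    [CategoryTheory.Linear R D] [F.Linear R]
    (n : ℕ) (X : C) (r : R) :
    (F.rightDerived n).map (r • 𝟙 X) = r • 𝟙 ((F.rightDerived n).obj X) := by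
  let P := injectiveResolution X
  have comm : P.aug ≫ (r • 𝟙 P.cocomplex : P.cocomplex ⟶ _).f 0 = (r • 𝟙 X) ≫ P.aug := by simp
  rw [← cancel_mono (P.isoRightDerivedObj F n).hom,
    InjectiveResolution.isoRightDerivedObj_hom_naturality (r • 𝟙 X) P P (r • 𝟙 _) comm F n]
  have h : (F.mapHomologicalComplex (ComplexShape.up ℕ)).map (r • 𝟙 P.cocomplex) = r • 𝟙 _ := by
    ext i
    simp
  have h2 : (HomologicalComplex.homologyFunctor D (ComplexShape.up ℕ) n).map
      (r • 𝟙 ((F.mapHomologicalComplex (ComplexShape.up ℕ)).obj P.cocomplex)) = r • 𝟙 _ := by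
    refine (ShortComplex.homologyMap_smul (R := R) (𝟙 _) r).trans ?_
    rw [ShortComplex.homologyMap_id]
    rfl
  rw [Functor.comp_map, h, h2]
  simp

end CategoryTheory.Functor

end LongExact

/-! ### Epimorphisms modulo a Serre class. -/

section Serre

open Limits

universe v w

variable {C : Type w} [Category.{v} C] [Abelian C] (P : ObjectProperty C) [P.IsSerreClass]

/-- By exactness the cokernel of the first map embeds in `X₃`. -/
theorem CategoryTheory.ObjectProperty.epiModSerre_of_exact {S : ShortComplex C} (hS : S.Exact)
    (h : P S.X₃) : P.epiModSerre S.f := by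
  have : Mono (cokernel.desc S.f S.g S.zero) := hS.mono_cokernelDesc
  exact P.prop_of_mono (cokernel.desc S.f S.g S.zero) h

theorem CategoryTheory.ObjectProperty.prop_of_epiModSerre {X Y : C} (f : X ⟶ Y)
    (hf : P.epiModSerre f) (hX : P X) : P Y :=
  P.prop_X₂_of_exact (ShortComplex.exact_cokernel f) hX hf

end Serre

/-! ### Vanishing above the number of generators of `I`. -/

section Vanishing

variable {R : Type u} [CommRing R]

/-- A submodule `N` of `E` into which linear maps from ideals extend to the ring, as in
Baer's criterion. -/
def Submodule.IsBaer {E : Type*} [AddCommGroup E] [Module R E] (N : Submodule R E) : Prop :=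
  ∀ (a : Ideal R) (f : a →ₗ[R] E), (∀ x, f x ∈ N) → ∃ e ∈ N, ∀ x : a, (x : R) • e = f x

theorem Submodule.isBaer_top {E : Type u} [AddCommGroup E] [Module R E] [Module.Injective R E] :
    (⊤ : Submodule R E).IsBaer := fun a f _ => by
  obtain ⟨g, hg⟩ := Module.Injective.out (Q := E) a.subtype a.subtype_injective f
  refine ⟨g 1, Submodule.mem_top, fun x => ?_⟩
  rw [← hg, ← map_smul, smul_eq_mul, mul_one]
  rfl

/-- The ascending chain of ideals `(a : sⁿ)` stabilizes. -/
theorem Ideal.exists_forall_pow_succ_mul_mem [IsNoetherianRing R] (a : Ideal R) (s : R) :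
    ∃ k : ℕ, ∀ r, s ^ (k + 1) * r ∈ a → s ^ k * r ∈ a := by
  let c : ℕ →o Ideal R :=
    { toFun := fun n => Submodule.comap (LinearMap.mulLeft R (s ^ n)) a
      monotone' := monotone_nat_of_le_succ fun n r hr => by
        simp only [Submodule.mem_comap, LinearMap.mulLeft_apply] at hr ⊢
        rw [pow_succ', mul_assoc]
        exact a.mul_mem_left _ hr }
  obtain ⟨k, hk⟩ := monotone_stabilizes_iff_noetherian.2 ‹IsNoetherian R R› c
  refine ⟨k, fun r hr => ?_⟩
  have : r ∈ c (k + 1) := hr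
  rwa [← hk (k + 1) k.le_succ] at this

theorem Submodule.exists_mem_smul_eq_zero_of_fg {E : Type*} [AddCommGroup E] [Module R E]
    (S : Submonoid R) {N : Submodule R E} (hN : N.FG) (h : ∀ x ∈ N, ∃ s ∈ S, s • x = 0) :
    ∃ s ∈ S, ∀ x ∈ N, s • x = 0 := by
  induction N, hN using Submodule.fg_induction with
  | singleton x =>
    obtain ⟨s, hs, hx⟩ := h x (Submodule.mem_span_singleton_self x)
    refine ⟨s, hs, fun y hy => ?_⟩
    obtain ⟨c, rfl⟩ := Submodule.mem_span_singleton.1 hy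
    rw [smul_comm, hx, smul_zero]
  | sup N₁ N₂ _ _ h₁ h₂ =>
    obtain ⟨s, hs, h₁⟩ := h₁ fun x hx => h x (Submodule.mem_sup_left hx)
    obtain ⟨t, ht, h₂⟩ := h₂ fun x hx => h x (Submodule.mem_sup_right hx)
    refine ⟨s * t, S.mul_mem hs ht, fun x hx => ?_⟩
    obtain ⟨y, hy, z, hz, rfl⟩ := Submodule.mem_sup.1 hx
    rw [smul_add, mul_comm, mul_smul, h₁ y hy, smul_zero, mul_comm, mul_smul, h₂ z hz, smul_zero,
      add_zero]

/-- The image of `f` is finitely generated, so a single `s ∈ S` kills it. Extending `f` by zero to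
`a + (s^(k+1))` before applying the hypothesis on `N` forces the resulting `e` to be killed by
`s^(k+1)`. -/
theorem Submodule.IsBaer.inf_torsion' [IsNoetherianRing R] {E : Type*} [AddCommGroup E]
    [Module R E] {N : Submodule R E} (hN : N.IsBaer) (S : Submonoid R) :
    (Submodule.torsion' R E S ⊓ N).IsBaer := fun a f hf => by
  obtain ⟨s, hs, h0⟩ : ∃ s ∈ S, ∀ x ∈ LinearMap.range f, s • x = 0 := by
    refine Submodule.exists_mem_smul_eq_zero_of_fg S ?_ ?_
    · rw [LinearMap.range_eq_map]
      exact Submodule.FG.map f (Module.Finite.fg_top)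
    · rintro _ ⟨x, rfl⟩
      obtain ⟨s, hs⟩ := (hf x).1
      exact ⟨s, s.2, hs⟩
  obtain ⟨k, hk⟩ := a.exists_forall_pow_succ_mul_mem s
  let F : R →ₗ.[R] E := ⟨a, f⟩
  let G : R →ₗ.[R] E := ⟨Ideal.span {s ^ (k + 1)}, 0⟩
  -- By the choice of `k`, an element of `a ∩ (s^(k+1))` is `s` times an element of `a`, so `f`
  -- kills it.
  have hFG (x : F.domain) (y : G.domain) (hxy : (x : R) = y) : F x = G y := by
    obtain ⟨r, hr⟩ := Ideal.mem_span_singleton'.1 y.2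
    have hr' : s ^ k * r ∈ a := hk r (by rw [mul_comm, hr, ← hxy]; exact x.2)
    have hx : x = s • (⟨s ^ k * r, hr'⟩ : a) := by
      apply Subtype.ext
      rw [hxy, ← hr]
      change r * s ^ (k + 1) = s * (s ^ k * r)
      ring
    change f x = 0
    rw [hx, map_smul]
    exact h0 _ ⟨_, rfl⟩
  obtain ⟨e, he, h⟩ := hN (F.sup G hFG).domain (F.sup G hFG).toFun (by
    rintro ⟨_, hx⟩
    obtain ⟨y, hy, z, hz, rfl⟩ := Submodule.mem_sup.1 hx
    have : (F.sup G hFG).toFun ⟨_, hx⟩ = F ⟨y, hy⟩ + G ⟨z, hz⟩ :=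
      LinearPMap.sup_apply hFG _ _ _ rfl
    rw [this]
    exact N.add_mem (hf ⟨y, hy⟩).2 N.zero_mem)
  have hl : F ≤ F.sup G hFG := LinearPMap.left_le_sup _ _ _
  have hr : G ≤ F.sup G hFG := LinearPMap.right_le_sup _ _ _
  refine ⟨e, ⟨⟨⟨s ^ (k + 1), S.pow_mem hs _⟩, ?_⟩, he⟩, fun x => ?_⟩
  · have hm : s ^ (k + 1) ∈ G.domain := Ideal.mem_span_singleton_self _
    exact (h ⟨_, hr.1 hm⟩).trans (hr.2 (x := ⟨_, hm⟩) rfl).symm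
  · exact (h ⟨_, hl.1 x.2⟩).trans (hl.2 (x := x) rfl).symm

/-- Division by `s` up to `s`-power torsion. Sending `s^(k+1)` to `s^k • e` is well defined once the
annihilators of `s^k` and `s^(k+1)` agree, and it extends to `R`. -/
theorem Submodule.IsBaer.exists_pow_succ_smul_eq [IsNoetherianRing R] {E : Type*} [AddCommGroup E]
    [Module R E] {N : Submodule R E} (hN : N.IsBaer) (s : R) {e : E} (he : e ∈ N) :
    ∃ k : ℕ, ∃ e' ∈ N, s ^ (k + 1) • e' = s ^ k • e := by
  obtain ⟨k, hk⟩ := (⊥ : Ideal R).exists_forall_pow_succ_mul_mem s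
  have H (c : R) (hc : c • s ^ (k + 1) = 0) : c • s ^ k • e = 0 := by
    have : s ^ k * c = 0 := hk c (by rw [mul_comm]; exact hc)
    rw [← mul_smul, mul_comm, this, zero_smul]
  let F : R →ₗ.[R] E := LinearPMap.mkSpanSingleton' (s ^ (k + 1)) (s ^ k • e) H
  obtain ⟨e', he', h⟩ := hN F.domain F.toFun (by
    rintro ⟨x, hx⟩
    obtain ⟨c, rfl⟩ := Submodule.mem_span_singleton.1 hx
    have : F.toFun ⟨_, hx⟩ = c • s ^ k • e := LinearPMap.mkSpanSingleton'_apply _ _ H c hx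
    rw [this]
    exact N.smul_mem _ (N.smul_mem _ he))
  refine ⟨k, e', he', ?_⟩
  have hm : s ^ (k + 1) ∈ F.domain := Submodule.mem_span_singleton_self _
  refine (h ⟨_, hm⟩).trans ?_
  exact LinearPMap.mkSpanSingleton'_apply_self _ _ H hm

/-- The submodule of the elements which are torsion with respect to each submonoid of a list. -/
def Submodule.listTorsion (E : Type*) [AddCommGroup E] [Module R E] :
    List (Submonoid R) → Submodule R E
  | [] => ⊤
  | S :: L => Submodule.torsion' R E S ⊓ listTorsion E L

theorem Submodule.mem_listTorsion_iff {E : Type*} [AddCommGroup E] [Module R E]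
    (L : List (Submonoid R)) (x : E) :
    x ∈ listTorsion E L ↔ ∀ S ∈ L, ∃ s ∈ S, s • x = 0 := by
  induction L with
  | nil => simp [listTorsion]
  | cons S L ih =>
    rw [listTorsion, Submodule.mem_inf, ih, List.forall_mem_cons]
    refine and_congr ⟨fun ⟨s, hs⟩ => ⟨s, s.2, hs⟩, fun ⟨s, hs, h⟩ => ⟨⟨s, hs⟩, h⟩⟩ Iff.rfl

theorem Submodule.map_mem_listTorsion {E E' : Type*} [AddCommGroup E] [Module R E]
    [AddCommGroup E'] [Module R E'] (L : List (Submonoid R)) (f : E →ₗ[R] E') {x : E}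
    (hx : x ∈ listTorsion E L) : f x ∈ listTorsion E' L := by
  rw [mem_listTorsion_iff] at hx ⊢
  intro S hS
  obtain ⟨s, hs, h⟩ := hx S hS
  exact ⟨s, hs, by rw [← map_smul, h, map_zero]⟩

theorem Submodule.isBaer_listTorsion [IsNoetherianRing R] {E : Type u} [AddCommGroup E]
    [Module R E] [Module.Injective R E] (L : List (Submonoid R)) : (listTorsion E L).IsBaer := by
  induction L with
  | nil => exact isBaer_top
  | cons S L ih => exact ih.inf_torsion' S

/-- Applying the torsion functor of a list of `r` submonoids to an exact complex of injective
modules yields a complex which is exact in degrees greater than `r`. -/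
theorem Submodule.exists_mem_listTorsion_d_eq [IsNoetherianRing R] {E : ℕ → Type u}
    [∀ n, AddCommGroup (E n)] [∀ n, Module R (E n)] [∀ n, Module.Injective R (E n)]
    (d : ∀ n, E n →ₗ[R] E (n + 1)) (hd : ∀ n x, d (n + 1) (d n x) = 0)
    (hE : ∀ n x, d (n + 1) x = 0 → ∃ y, d n y = x) (L : List (Submonoid R)) :
    ∀ n, L.length ≤ n → ∀ z ∈ listTorsion (E (n + 1)) L, d (n + 1) z = 0 →
      ∃ y ∈ listTorsion (E n) L, d n y = z := by
  induction L with
  | nil =>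
    intro n _ z _ hz
    obtain ⟨y, hy⟩ := hE n z hz
    exact ⟨y, Submodule.mem_top, hy⟩
  | cons S L ih =>
    rintro (_ | n) hn z ⟨⟨s, hs⟩, hzL⟩ hz
    · simp at hn
    have hn : L.length ≤ n := by simpa using hn
    obtain ⟨y, hyL, rfl⟩ := ih (n + 1) (hn.trans n.le_succ) z hzL hz
    -- Here `s • y` is a cocycle because `s` kills `z = d y`. Using exactness one degree lower is
    -- what costs a degree per submonoid.
    obtain ⟨w, hwL, hw⟩ := ih n hn ((s : R) • y) (Submodule.smul_mem _ _ hyL) (by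
      rw [map_smul]
      exact hs)
    obtain ⟨k, w', hw'L, hw'⟩ := (isBaer_listTorsion L).exists_pow_succ_smul_eq (s : R) hwL
    -- Since `s • y = d w` and `s^(k+1) • w' = s^k • w`, the corrected preimage `y - d w'` is killed
    -- by `s^(k+1)`.
    refine ⟨y - d n w', ⟨⟨s ^ (k + 1), ?_⟩, ?_⟩, ?_⟩
    · change ((s : R) ^ (k + 1)) • (y - d n w') = 0
      rw [smul_sub, ← map_smul, hw', map_smul, hw, ← mul_smul, ← pow_succ, sub_self]
    · exact Submodule.sub_mem _ hyL (map_mem_listTorsion L _ hw'L)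
    · rw [map_sub, hd, sub_zero]

/-- The submonoid of all elements congruent modulo `J` to a power of `x`. -/
def Ideal.powersAdd (J : Ideal R) (x : R) : Submonoid R :=
  (Submonoid.powers (Ideal.Quotient.mk J x)).comap (Ideal.Quotient.mk J)

theorem Ideal.mem_powersAdd {J : Ideal R} {x s : R} :
    s ∈ J.powersAdd x ↔ ∃ n : ℕ, x ^ n - s ∈ J := by
  simp only [powersAdd, Submonoid.mem_comap, Submonoid.mem_powers_iff, ← map_pow,
    Ideal.Quotient.eq]

/-- If no element congruent modulo `J` to a power of `x` kills `m`, some prime containing `Ann m`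
avoids all such elements, so no power of `x` lies in `p + J`. Conversely, killing elements lie in
every prime of the support, which puts each generator in the radical of `p + J`. -/
theorem pairTorsion_eq_listTorsion (J : Ideal R) (l : List R) (N : Type u) [AddCommGroup N]
    [Module R N] :
    pairTorsion (Ideal.span {x | x ∈ l}) J N = Submodule.listTorsion N (l.map J.powersAdd) := by
  ext m
  rw [Submodule.mem_listTorsion_iff, List.forall_mem_map]
  constructor
  · intro hm x hx
    by_contra! h
    let a : Ideal R := LinearMap.ker (LinearMap.toSpanSingleton R N m)
    have ha (r : R) : r ∈ a ↔ r • m = 0 := LinearMap.mem_ker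
    obtain ⟨p, hp, hap, hpS⟩ := Ideal.exists_le_prime_disjoint a (J.powersAdd x)
      (Set.disjoint_left.2 fun r hr hrS => h r hrS ((ha r).1 hr))
    obtain ⟨n, -, hn⟩ := hm ((mem_support_span_singleton_iff m ⟨p, hp⟩).2
      fun r hr => hap ((ha r).2 hr))
    have hxl : x ∈ Ideal.span {x | x ∈ l} := Ideal.subset_span hx
    obtain ⟨y, hy, j, hj, hyj⟩ := Submodule.mem_sup.1 (hn (Ideal.pow_mem_pow hxl n))
    refine Set.disjoint_left.1 hpS hy (Ideal.mem_powersAdd.2 ⟨n, ?_⟩)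
    rwa [← hyj, add_sub_cancel_left]
  · intro h p hp
    rw [mem_support_span_singleton_iff] at hp
    have hrad : Ideal.span {x | x ∈ l} ≤ (p.asIdeal ⊔ J).radical := by
      refine Ideal.span_le.2 fun x hx => ?_
      obtain ⟨s, hs, hsm⟩ := h x hx
      obtain ⟨n, hn⟩ := Ideal.mem_powersAdd.1 hs
      refine ⟨n, ?_⟩
      rw [← add_sub_cancel s (x ^ n)]
      exact Submodule.add_mem_sup (hp s hsm) hn
    have hfg : (Ideal.span {x | x ∈ l}).FG := by
      classical
      exact ⟨l.toFinset, by simp [Ideal.span]⟩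
    obtain ⟨n, hn⟩ := Ideal.exists_pow_le_of_le_radical_of_fg hrad hfg
    -- The exponent is raised by one because `pairW` asks for a positive one.
    exact ⟨n + 1, by lia, (Ideal.pow_le_pow_right n.le_succ).trans hn⟩

/-- The local cohomology with respect to `(I, J)` vanishes in degrees greater than the number of
generators of `I`. -/
theorem isZero_pairLocalCohomology_of_length_lt [IsNoetherianRing R] (J : Ideal R) (l : List R)
    (N : ModuleCat.{u} R) {i : ℕ} (hi : l.length < i) :
    Limits.IsZero ((pairLocalCohomology (Ideal.span {x | x ∈ l}) J i).obj N) := by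
  obtain ⟨n, rfl⟩ : ∃ n, i = n + 1 := ⟨i - 1, by lia⟩
  let P := injectiveResolution N
  let K := P.cocomplex
  have hinj (n : ℕ) : Module.Injective R (K.X n) :=
    Module.injective_module_of_injective_object (inj := P.injective n)
  refine Limits.IsZero.of_iso ?_ (P.isoRightDerivedObj (pairTorsionFunctor _ J) (n + 1))
  refine ((HomologicalComplex.exactAt_iff' _ n (n + 1) (n + 2) (by simp) (by simp)).2
    ?_).isZero_homology
  rw [ShortComplex.moduleCat_exact_iff]
  rintro ⟨z, hz⟩ hdz
  have hdz : K.d (n + 1) (n + 2) z = 0 := congrArg Subtype.val hdz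
  rw [pairTorsion_eq_listTorsion] at hz
  obtain ⟨y, hy, hyz⟩ := Submodule.exists_mem_listTorsion_d_eq
    (E := fun n => K.X n) (fun n => (K.d n (n + 1)).hom)
    (fun n x => by simp [← ModuleCat.comp_apply])
    (fun n x hx => (ShortComplex.moduleCat_exact_iff _).1 (P.exact_succ n) x hx)
    (l.map J.powersAdd) n (by simpa using Nat.lt_succ_iff.1 hi) z hz hdz
  rw [← pairTorsion_eq_listTorsion] at hy
  exact ⟨⟨y, hy⟩, Subtype.ext hyz⟩

/-- Over a noetherian ring, the cohomological dimension of a pair of ideals is finite. -/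
theorem exists_forall_isZero_pairLocalCohomology [IsNoetherianRing R] (I J : Ideal R) :
    ∃ r : ℕ, ∀ i, r < i → ∀ N : ModuleCat.{u} R,
      Limits.IsZero ((pairLocalCohomology I J i).obj N) := by
  obtain ⟨t, ht⟩ := IsNoetherian.noetherian I
  obtain rfl : Ideal.span {x | x ∈ t.toList} = I := by
    rw [← ht]
    simp [Ideal.span]
  exact ⟨_, fun i hi N => isZero_pairLocalCohomology_of_length_lt J t.toList N hi⟩

end Vanishing

/-! ### Local cohomology of a pair modulo a Serre class. -/

section Serre

variable {R : Type u} [CommRing R] (I J : Ideal R)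

instance pairTorsionFunctor_linear : (pairTorsionFunctor I J).Linear R where

instance pairLocalCohomology_additive (i : ℕ) : (pairLocalCohomology I J i).Additive :=
  Functor.rightDerived_additive _ i

theorem pairLocalCohomology_map_smul (i : ℕ) (N : ModuleCat.{u} R) (r : R) :
    (pairLocalCohomology I J i).map (r • 𝟙 N) = r • 𝟙 _ :=
  Functor.rightDerived_map_smul _ i N r

/-- A short exact sequence of linear maps gives a short exact sequence in `ModuleCat R`. -/
theorem shortExact_ofHom {A B C : Type u} [AddCommGroup A] [AddCommGroup B] [AddCommGroup C]
    [Module R A] [Module R B] [Module R C] (f : A →ₗ[R] B) (g : B →ₗ[R] C)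
    (hf : Function.Injective f) (hg : Function.Surjective g) (h : Function.Exact f g) :
    (ShortComplex.mk (ModuleCat.ofHom f) (ModuleCat.ofHom g) (by
      ext x
      exact h.apply_apply_eq_zero x)).ShortExact where
  exact := (ShortComplex.ShortExact.moduleCat_exact_iff_function_exact _).2 h
  mono_f := (ModuleCat.mono_iff_injective _).2 hf
  epi_g := (ModuleCat.epi_iff_surjective _).2 hg

variable (S : ObjectProperty (ModuleCat.{u} R)) [S.IsSerreClass]

/-- Modulo `S`, the functor `Hⁱ` preserves the surjectivity of `g` if `Hⁱ⁺¹` of the kernel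
of `g` is in `S`. -/
theorem epiModSerre_pairLocalCohomology_map {B C : Type u} [AddCommGroup B] [AddCommGroup C]
    [Module R B] [Module R C] (g : B →ₗ[R] C) (hg : Function.Surjective g) (i : ℕ)
    (hK : S ((pairLocalCohomology I J (i + 1)).obj (ModuleCat.of R (LinearMap.ker g)))) :
    S.epiModSerre ((pairLocalCohomology I J i).map (ModuleCat.ofHom g)) := by
  obtain ⟨δ, w, h⟩ := (pairTorsionFunctor I J).rightDerived_exact₃ (shortExact_ofHom
    (LinearMap.ker g).subtype g (Submodule.subtype_injective _) hg
    (LinearMap.exact_subtype_ker_map g)) i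
  exact S.epiModSerre_of_exact h hK

/-- Modulo `S`, the map `Hⁱ(f)` is surjective if `f` is injective and `Hⁱ` of the cokernel
is in `S`. -/
theorem epiModSerre_pairLocalCohomology_map_of_exact {A B C : Type u} [AddCommGroup A]
    [AddCommGroup B] [AddCommGroup C] [Module R A] [Module R B] [Module R C]
    (f : A →ₗ[R] B) (g : B →ₗ[R] C) (hf : Function.Injective f)
    (hg : Function.Surjective g) (h : Function.Exact f g) (i : ℕ)
    (hC : S ((pairLocalCohomology I J i).obj (ModuleCat.of R C))) :
    S.epiModSerre ((pairLocalCohomology I J i).map (ModuleCat.ofHom f)) :=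
  S.epiModSerre_of_exact
    ((pairTorsionFunctor I J).rightDerived_exact₂ (shortExact_ofHom f g hf hg h) i) hC

theorem prop_pairLocalCohomology_of_exact {A B C : Type u} [AddCommGroup A]
    [AddCommGroup B] [AddCommGroup C] [Module R A] [Module R B] [Module R C]
    (f : A →ₗ[R] B) (g : B →ₗ[R] C) (hf : Function.Injective f)
    (hg : Function.Surjective g) (h : Function.Exact f g) (i : ℕ)
    (hA : S ((pairLocalCohomology I J i).obj (ModuleCat.of R A)))
    (hC : S ((pairLocalCohomology I J i).obj (ModuleCat.of R C))) :
    S ((pairLocalCohomology I J i).obj (ModuleCat.of R B)) :=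
  S.prop_X₂_of_exact
    ((pairTorsionFunctor I J).rightDerived_exact₂ (shortExact_ofHom f g hf hg h) i) hA hC

/-- There is a nonzero map from a finite module to the quotient by any prime containing its
annihilator. -/
theorem exists_linearMap_quotient_prime_ne_zero [IsNoetherianRing R] (M : Type u) [AddCommGroup M]
    [Module R M] [Module.Finite R M] (p : Ideal R) [p.IsPrime]
    (hp : Module.annihilator R M ≤ p) : ∃ f : M →ₗ[R] R ⧸ p, f ≠ 0 := by
  by_contra! h
  have hsub : Subsingleton (M →ₗ[R] R ⧸ p) := ⟨fun f g => (h f).trans (h g).symm⟩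
  -- If `Hom(M, R/p) = 0`, then `Ann M` contains an `R/p`-regular element; but `Ann M ≤ p` kills
  -- `R/p`.
  obtain ⟨r, hr, hreg⟩ := IsSMulRegular.subsingleton_linearMap_iff.1 hsub
  refine one_ne_zero (α := R ⧸ p) (hreg ?_)
  change r • (1 : R ⧸ p) = r • 0
  rw [smul_zero, Algebra.smul_def, mul_one]
  exact Ideal.Quotient.eq_zero_iff_mem.2 (hp hr)

/-- The step of the descending induction in `prop_pairLocalCohomology_of_annihilator_le`. -/
theorem prop_pairLocalCohomology_of_succ [IsNoetherianRing R] (M : Type u) [AddCommGroup M]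
    [Module R M] [Module.Finite R M] (i : ℕ)
    (hM : S ((pairLocalCohomology I J i).obj (ModuleCat.of R M)))
    (hsucc : ∀ (N : Type u) [AddCommGroup N] [Module R N] [Module.Finite R N],
      Module.annihilator R M ≤ Module.annihilator R N →
        S ((pairLocalCohomology I J (i + 1)).obj (ModuleCat.of R N)))
    (c : Ideal R) (hc : Module.annihilator R M ≤ c) :
    ∀ (N : Type u) [AddCommGroup N] [Module R N] [Module.Finite R N],
      c ≤ Module.annihilator R N →
        S ((pairLocalCohomology I J i).obj (ModuleCat.of R N)) := by
  -- Noetherian induction on the annihilating ideal, combined with dévissage to modules `R/p`.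
  induction c using WellFoundedGT.induction with
  | ind c ih =>
  intro N _ _ hN hcN
  induction hN using IsNoetherianRing.induction_on_isQuotientEquivQuotientPrime R with
  | subsingleton N =>
    exact S.prop_of_isZero (Functor.map_isZero _ (ModuleCat.isZero_of_subsingleton _))
  | quotient N p e =>
    have hp : c ≤ p.asIdeal := by
      rwa [e.annihilator_eq, Ideal.annihilator_quotient] at hcN
    obtain ⟨f', hf'⟩ := exists_linearMap_quotient_prime_ne_zero M p.asIdeal (hc.trans hp)
    let f : M →ₗ[R] N := e.symm.toLinearMap.comp f'
    obtain ⟨x, hx⟩ : ∃ x, f' x ≠ 0 := by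
      by_contra! h
      exact hf' (LinearMap.ext h)
    obtain ⟨y, hy⟩ := Ideal.Quotient.mk_surjective (f' x)
    have hyp : y ∉ p.asIdeal := fun h => hx (hy ▸ Ideal.Quotient.eq_zero_iff_mem.2 h)
    -- With `N ≅ R/p`, the class of `y` lies in the image, so `y` kills the cokernel, while `y ∉ p ⊇
    -- c`.
    have hcok : c < Module.annihilator R (N ⧸ LinearMap.range f) := by
      refine lt_of_le_of_ne (hcN.trans
        (LinearMap.annihilator_le_of_surjective _ (Submodule.mkQ_surjective _))) fun h => ?_
      refine hyp (hp (h ▸ Module.mem_annihilator.2 fun z => ?_))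
      obtain ⟨z, rfl⟩ := Submodule.mkQ_surjective _ z
      rw [← map_smul, Submodule.mkQ_apply, Submodule.Quotient.mk_eq_zero]
      obtain ⟨r, hr⟩ := Ideal.Quotient.mk_surjective (e z)
      refine ⟨r • x, ?_⟩
      change e.symm (f' (r • x)) = _
      rw [LinearEquiv.symm_apply_eq, map_smul, map_smul, ← hy, ← hr]
      change Ideal.Quotient.mk _ (r * y) = Ideal.Quotient.mk _ (y * r)
      rw [mul_comm]
    refine prop_pairLocalCohomology_of_exact I J S (LinearMap.range f).subtype
      (LinearMap.range f).mkQ (Submodule.subtype_injective _) (Submodule.mkQ_surjective _)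
      (LinearMap.exact_subtype_mkQ _) i ?_ (ih _ hcok (hc.trans hcok.le) _ le_rfl)
    -- Modulo `S`, `Hⁱ(M)` maps onto `Hⁱ(im f)`: the kernel of `f` is a submodule of `M`, so its
    -- `Hⁱ⁺¹` lies in `S`.
    exact S.prop_of_epiModSerre _ (epiModSerre_pairLocalCohomology_map I J S f.rangeRestrict
      f.surjective_rangeRestrict i (hsucc _
        (LinearMap.annihilator_le_of_injective _ (Submodule.subtype_injective _)))) hM
  | exact N₁ N₂ N₃ f g hf hg hfg h₁ h₃ =>
    exact prop_pairLocalCohomology_of_exact I J S f g hf hg hfg i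
      (h₁ (hcN.trans (LinearMap.annihilator_le_of_injective f hf)))
      (h₃ (hcN.trans (LinearMap.annihilator_le_of_surjective g hg)))

/-- If the local cohomology of `M` is in a Serre class in all degrees greater than `n`, then so is
the local cohomology of all finite modules annihilated by the annihilator of `M`. -/
theorem prop_pairLocalCohomology_of_annihilator_le [IsNoetherianRing R] (M : Type u)
    [AddCommGroup M] [Module R M] [Module.Finite R M] (n : ℕ)
    (hM : ∀ i : ℕ, n < i → S ((pairLocalCohomology I J i).obj (ModuleCat.of R M)))
    (i : ℕ) (hi : n < i) (N : Type u) [AddCommGroup N] [Module R N] [Module.Finite R N]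
    (hN : Module.annihilator R M ≤ Module.annihilator R N) :
    S ((pairLocalCohomology I J i).obj (ModuleCat.of R N)) := by
  obtain ⟨r, hr⟩ := exists_forall_isZero_pairLocalCohomology I J
  -- Descending induction on `i`, run as induction on `k`; for `k = 0` the cohomology vanishes.
  have key (k : ℕ) : ∀ i, n < i → r < i + k → ∀ (N : Type u) [AddCommGroup N] [Module R N]
      [Module.Finite R N], Module.annihilator R M ≤ Module.annihilator R N →
        S ((pairLocalCohomology I J i).obj (ModuleCat.of R N)) := by
    induction k with
    | zero => exact fun i _ h N _ _ _ _ => S.prop_of_isZero (hr i h _)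
    | succ k ih =>
      exact fun i hi h => prop_pairLocalCohomology_of_succ I J S M i (hM i hi)
        (ih (i + 1) (by lia) (by lia)) _ le_rfl
  exact key (r + 1) i hi (by lia) N hN

end Serre

theorem theorem4p7 {R : Type u} [CommRing R] [IsNoetherianRing R] (I J : Ideal R)
    (S : ObjectProperty (ModuleCat.{u} R)) [S.IsSerreClass]
    (M : Type u) [AddCommGroup M] [Module R M] [Module.Finite R M] (n : ℕ)
    (hM : ∀ i : ℕ, n < i → S ((pairLocalCohomology I J i).obj (ModuleCat.of R M)))
    (b : Ideal R)
    (hb : S ((pairLocalCohomology I J n).obj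
      (ModuleCat.of R (M ⧸ (b • ⊤ : Submodule R M))))) :
    S (ModuleCat.of R
      (((pairLocalCohomology I J n).obj (ModuleCat.of R M)) ⧸
        (b • ⊤ : Submodule R ((pairLocalCohomology I J n).obj (ModuleCat.of R M))))) := by
  obtain ⟨t, rfl⟩ := IsNoetherian.noetherian b
  set b : Ideal R := Submodule.span R t with hbt
  let φ : (t → M) →ₗ[R] M := ∑ x : t, (x : R) • LinearMap.proj x
  have hφ (m : t → M) : φ m = ∑ x : t, (x : R) • m x := by simp [φ]
  have hmem (x : t) : (x : R) ∈ b := Submodule.subset_span x.2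
  have hrange : LinearMap.range φ = b • ⊤ := by
    apply le_antisymm
    · rintro _ ⟨m, rfl⟩
      rw [hφ]
      exact Submodule.sum_mem _ fun x _ => Submodule.smul_mem_smul (hmem x) Submodule.mem_top
    · rw [hbt, Submodule.span_smul_eq, Submodule.set_smul_le_iff]
      intro r y hr _
      classical
      refine ⟨Pi.single ⟨r, hr⟩ y, ?_⟩
      rw [hφ, Finset.sum_eq_single ⟨r, hr⟩]
      · simp
      · intro x _ hx
        simp [hx]
      · simp
  let H := pairLocalCohomology I J n
  have hepi : S.epiModSerre (H.map (ModuleCat.ofHom φ)) := by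
    have h₁ := epiModSerre_pairLocalCohomology_map I J S φ.rangeRestrict φ.surjective_rangeRestrict n
      -- The kernel sits inside `t → M`, so `Ann M` kills it.
      (prop_pairLocalCohomology_of_annihilator_le I J S M n hM (n + 1) n.lt_succ_self _ (by
        refine le_trans ?_ (LinearMap.annihilator_le_of_injective _ (Submodule.subtype_injective _))
        intro r hr
        refine Module.mem_annihilator.2 fun m => funext fun x => ?_
        exact Module.mem_annihilator.1 hr (m x)))
    have h₂ := epiModSerre_pairLocalCohomology_map_of_exact I J S (LinearMap.range φ).subtype
      (LinearMap.range φ).mkQ (Submodule.subtype_injective _) (Submodule.mkQ_surjective _)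
      (LinearMap.exact_subtype_mkQ _) n (by rwa [hrange])
    have h := S.epiModSerre.comp_mem _ _ h₁ h₂
    rwa [← Functor.map_comp] at h
  have hφsum : ModuleCat.ofHom φ =
      ∑ x : t, ModuleCat.ofHom (LinearMap.proj x) ≫ ((x : R) • 𝟙 (ModuleCat.of R M)) := by
    ext m
    simp [φ]
  let q := ModuleCat.ofHom (b • ⊤ : Submodule R (H.obj (ModuleCat.of R M))).mkQ
  have hq : H.map (ModuleCat.ofHom φ) ≫ q = 0 := by
    rw [hφsum, Functor.map_sum, Preadditive.sum_comp]
    refine Finset.sum_eq_zero fun x _ => ?_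
    -- Each summand of `H(φ)` ends in multiplication by some `x ∈ b`, which is zero modulo `bH(M)`.
    rw [Functor.map_comp, pairLocalCohomology_map_smul, Category.assoc]
    have : ((x : R) • 𝟙 (H.obj (ModuleCat.of R M))) ≫ q = 0 := by
      ext y
      exact (Submodule.Quotient.mk_eq_zero _).2
        (Submodule.smul_mem_smul (hmem x) Submodule.mem_top)
    exact (congrArg _ this).trans Limits.comp_zero
  have hqe : Epi q := (ModuleCat.epi_iff_surjective _).2 (Submodule.mkQ_surjective _)
  have : Epi (Limits.cokernel.desc (H.map (ModuleCat.ofHom φ)) q hq) :=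
    epi_of_epi_fac (Limits.cokernel.π_desc _ _ _)
  exact S.prop_of_epi (Limits.cokernel.desc (H.map (ModuleCat.ofHom φ)) q hq) hepi
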